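/- Let $n$ be a natural number and $\hbar>0$. Equip $\mathbb{R}^{2n}=\mathbb{R}^n_x\times\mathbb{R}^n_p$ with the Euclidean scalar product and the standard symplectic form $\sigma(z,z')=Jz\cdot z'$, $J=\begin{pmatrix}0&I\\-I&0\end{pmatrix}$, and let $\operatorname{Sp}(n)$ be the group of real $2n\times 2n$ matrices $S$ with $S^TJS=J$. Let $M$ be a real symmetric positive definite $2n\times 2n$ matrix, let $\Omega_M=\{z\in\mathbb{R}^{2n}: Mz\cdot z\le\hbar\}$, and let $$\Omega_M^{\hbar,\sigma}=\{z'\in\mathbb{R}^{2n}:\sup_{z\in\Omega_M}\sigma(z,z')\le\hbar\}$$ be its symplectic polar dual. The ellipsoid $\Omega_M$ is called quantum admissible if it contains a quantum blob, i.e. if $S(B^{2n}(\sqrt\hbar))\subset\Omega_M$ for some $S\in\operatorname{Sp}(n)$, where $B^{2n}(\sqrt\hbar)$ is the closed ball of radius $\sqrt\hbar$ centered at $0$. A symplectic plane is a two-dimensional linear subspace $F\subset\mathbb{R}^{2n}$ such that $\sigma|_F$ is non-degenerate; $\operatorname{Area}$ denotes the symplectic area on $F$, that is, $\operatorname{Area}(A)=\left|\int_A\sigma\right|$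 with respect to the area form $\sigma|_F$ (the translation-invariant measure on $F$ for which the parallelogram spanned by $u,v\in F$ has area $|\sigma(u,v)|$). Then the following three statements are equivalent: $\Omega_M$ is quantum admissible; (i) $\Omega_M^{\hbar,\sigma}\subset\Omega_M$; (ii) $\operatorname{Area}(\Omega_M^{\hbar,\sigma}\cap F)\le\pi\hbar$ for every symplectic plane $F$ in $(\mathbb{R}^{2n},\sigma)$. -/

import Mathlib

noncomputable section

namespace SymplecticPolarity

/-- The phase space `ℝ²ⁿ = ℝⁿ_x × ℝⁿ_p` with its Euclidean structure; `Sum.inl` indexes the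
position coordinates and `Sum.inr` the momentum coordinates. -/
abbrev PhaseSpace (n : ℕ) : Type := EuclideanSpace ℝ (Fin n ⊕ Fin n)

/-- The standard symplectic matrix `J = (0, I; -I, 0)`. It is `-Matrix.J`, so `S J Sᵀ = J`
says that `S ∈ Matrix.symplecticGroup (Fin n) ℝ`. -/
def stdJ (n : ℕ) : Matrix (Fin n ⊕ Fin n) (Fin n ⊕ Fin n) ℝ := Matrix.fromBlocks 0 1 (-1) 0

/-- The standard symplectic form `σ(z, z') = Jz · z'`. -/
def sigma (n : ℕ) : LinearMap.BilinForm ℝ (PhaseSpace n) :=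
  LinearMap.mk₂ ℝ (fun z w => inner ℝ ((stdJ n).toEuclideanLin z) w)
    (fun z z' w => by rw [map_add, inner_add_left])
    (fun c z w => by rw [map_smul, real_inner_smul_left, smul_eq_mul])
    (fun z w w' => inner_add_right _ _ _)
    (fun c z w => by rw [real_inner_smul_right, smul_eq_mul])

/-- In coordinates, `σ((x, p), (x', p')) = p · x' - x · p'`. -/
theorem sigma_apply (n : ℕ) (z w : PhaseSpace n) :
    sigma n z w = ∑ i, (z (Sum.inr i) * w (Sum.inl i) - z (Sum.inl i) * w (Sum.inr i)) := by
  simp [sigma, stdJ, PiLp.inner_apply, Matrix.toLpLin_apply, Matrix.mulVec, dotProduct,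
    Matrix.fromBlocks, Matrix.one_apply, Finset.sum_add_distrib, mul_comm, sub_eq_add_neg]

theorem sigma_self (n : ℕ) (z : PhaseSpace n) : sigma n z z = 0 := by
  rw [sigma_apply]
  exact Finset.sum_eq_zero fun i _ => by ring

/-- The restriction of `σ` to a subspace `F`, as an alternating 2-form on `F`. -/
def sigmaForm {n : ℕ} (F : Submodule ℝ (PhaseSpace n)) : F [⋀^Fin 2]→ₗ[ℝ] ℝ :=
  AlternatingMap.mk
    (MultilinearMap.mk' (fun v : Fin 2 → F => sigma n (v 0) (v 1))
      (fun v i x y => by fin_cases i <;> simp)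
      (fun v i c x => by fin_cases i <;> simp))
    (fun v i j h hij => by
      have h01 : v 0 = v 1 := by
        fin_cases i <;> fin_cases j <;> simp_all
      simp [h01, sigma_self])

/-- A symplectic plane: a two-dimensional subspace on which `σ` is non-degenerate. -/
structure IsSymplecticPlane {n : ℕ} (F : Submodule ℝ (PhaseSpace n)) : Prop where
  finrank_eq : Module.finrank ℝ F = 2
  nondegenerate : ((sigma n).restrict F).Nondegenerate

/-- The (symplectic) area of `A ∩ F`, for a two-dimensional subspace `F`: the integral of the
area form `σ|F` over `A ∩ F` in absolute value, that is, the measure of `A ∩ F` for the unique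
translation-invariant measure on `F` which gives the mass `|σ(u, v)|` to the parallelogram
spanned by `u, v ∈ F`. -/
def areaInter {n : ℕ} (A : Set (PhaseSpace n)) (F : Submodule ℝ (PhaseSpace n))
    (hF : Module.finrank ℝ F = 2) : ENNReal :=
  haveI : Fact (Module.finrank ℝ F = 2) := ⟨hF⟩
  (sigmaForm F).measure {z : F | (z : PhaseSpace n) ∈ A}

/-- The centered ellipsoid `Ω_M = {z : Mz · z ≤ ħ}`. -/
def ellipsoid {n : ℕ} (hbar : ℝ) (M : Matrix (Fin n ⊕ Fin n) (Fin n ⊕ Fin n) ℝ) :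
    Set (PhaseSpace n) :=
  {z | inner ℝ (M.toEuclideanLin z) z ≤ hbar}

/-- The symplectic polar dual `Ω^{ħ,σ} = {z' : sup_{z ∈ Ω} σ(z, z') ≤ ħ}`. -/
def symplecticPolar {n : ℕ} (hbar : ℝ) (A : Set (PhaseSpace n)) : Set (PhaseSpace n) :=
  {w | ∀ z ∈ A, sigma n z w ≤ hbar}

/-- The centered quantum blob `Q_S = S(B²ⁿ(√ħ))`. -/
def quantumBlob {n : ℕ} (hbar : ℝ) (S : Matrix (Fin n ⊕ Fin n) (Fin n ⊕ Fin n) ℝ) :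
    Set (PhaseSpace n) :=
  S.toEuclideanLin '' Metric.closedBall (0 : PhaseSpace n) (Real.sqrt hbar)

/-- A set is quantum admissible if it contains a quantum blob `Q_S`, `S ∈ Sp(n)`. -/
def QuantumAdmissible {n : ℕ} (hbar : ℝ) (A : Set (PhaseSpace n)) : Prop :=
  ∃ S ∈ Matrix.symplecticGroup (Fin n) ℝ, quantumBlob hbar S ⊆ A

end SymplecticPolarity

end

open MeasureTheory

/-! Write M = R² with R positive definite. Then Ω_M is {‖Rz‖ ≤ √ħ}, its polar dual is {‖R⁻¹Jz‖ ≤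
√ħ}, and everything is governed by the invertible skew matrix K = R⁻¹JR⁻¹: substituting z = R⁻¹x,
the inclusion of the polar dual in Ω_M reads ‖x‖ ≤ ‖Kx‖, that is KᵀK ≥ 1.

Admissible ⇒ (i): polarity reverses inclusions and fixes quantum blobs.

(i) ⇒ (ii): if b₀, b₁ ∈ F are orthonormal for the norm ‖R⁻¹J·‖, the section has area |σ(b₀, b₁)|πħ,
and Cauchy–Schwarz gives |σ(b₀, b₁)| ≤ 1 (`areaInter_symplecticPolar_le`).

(ii) ⇒ admissible: an eigenvector x of KᵀK with eigenvalue c yields the symplectic plane spanned by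
R⁻¹x and R⁻¹Kx, whose section has area πħ/√c. So (ii) forces KᵀK ≥ 1
(`posSemidef_sub_one_of_areaInter_le`). With P = |K| ≥ 1, the matrix N = RPR is positive definite
and symplectic and dominates M; S = N^(-1/2) is again symplectic and its blob {Nz·z ≤ ħ} lies in Ω_M
(`exists_posDef_symplectic`). -/

namespace SymplecticPolarity

/-! ### Areas of ellipses -/

/-- In linear coordinates, the measure of an alternating form is a multiple of Lebesgue measure. -/
theorem measure_preimage_linearEquiv {G : Type*} [NormedAddCommGroup G] [NormedSpace ℝ G]
    [MeasurableSpace G] [BorelSpace G] [FiniteDimensional ℝ G] {m : ℕ}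
    [Fact (Module.finrank ℝ G = m)] (ω : G [⋀^Fin m]→ₗ[ℝ] ℝ)
    (e : G ≃ₗ[ℝ] EuclideanSpace ℝ (Fin m)) (s : Set (EuclideanSpace ℝ (Fin m))) :
    ω.measure (e ⁻¹' s) =
      ENNReal.ofReal |ω fun i => e.symm (EuclideanSpace.single i 1)| * volume s := by
  let f : G ≃L[ℝ] EuclideanSpace ℝ (Fin m) := e.toContinuousLinearEquiv
  have hmap (t) : (ω.measure.map f) t = ω.measure (e ⁻¹' t) :=
    f.toHomeomorph.toMeasurableEquiv.map_apply t
  have : (ω.measure.map f).IsAddLeftInvariant :=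
    isAddLeftInvariant_map (e.toAddEquiv : G →ₙ+ EuclideanSpace ℝ (Fin m))
      f.continuous.measurable f.surjective
  have : IsLocallyFiniteMeasure (ω.measure.map f) := by
    refine ⟨fun x => ?_⟩
    obtain ⟨t, ht, hlt⟩ := ω.measure.finiteAt_nhds (f.symm x)
    refine ⟨f.symm ⁻¹' t, f.symm.continuous.continuousAt ht, ?_⟩
    rw [hmap]
    convert hlt
    ext z
    simp [f]
  have huniq := Measure.isAddLeftInvariant_eq_smul (ω.measure.map f)
    (volume : Measure (EuclideanSpace ℝ (Fin m)))
  set c := Measure.addHaarScalarFactor (ω.measure.map f)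
    (volume : Measure (EuclideanSpace ℝ (Fin m)))
  -- The factor is found by evaluating both measures on the unit cube.
  have hc : (c : ENNReal) = ENNReal.ofReal |ω fun i => e.symm (EuclideanSpace.single i 1)| := by
    have h1 := (EuclideanSpace.basisFun (Fin m) ℝ).volume_parallelepiped
    have h2 := hmap (parallelepiped (EuclideanSpace.basisFun (Fin m) ℝ))
    rw [huniq, Measure.smul_apply, h1, ← e.image_symm_eq_preimage] at h2
    have h3 := image_parallelepiped (e.symm : EuclideanSpace ℝ (Fin m) →ₗ[ℝ] G)
      (EuclideanSpace.basisFun (Fin m) ℝ)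
    rw [LinearEquiv.coe_coe] at h3
    rw [h3, AlternatingMap.measure_parallelepiped] at h2
    simpa [ENNReal.smul_def, Function.comp_def] using h2
  rw [← hmap, huniq, Measure.smul_apply, ← hc, ENNReal.smul_def, smul_eq_mul]

/-- Coordinates in the basis `b` turn ‖L z‖ into the Euclidean norm, so the set becomes a round disc
of radius r. -/
theorem measure_norm_apply_le {G E : Type*} [NormedAddCommGroup G] [NormedSpace ℝ G]
    [MeasurableSpace G] [BorelSpace G] [FiniteDimensional ℝ G] [Fact (Module.finrank ℝ G = 2)]
    [NormedAddCommGroup E] [InnerProductSpace ℝ E] (ω : G [⋀^Fin 2]→ₗ[ℝ] ℝ) (L : G →ₗ[ℝ] E)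
    (b : Fin 2 → G) (hb : Orthonormal ℝ (L ∘ b)) (r : ℝ) :
    ω.measure {z | ‖L z‖ ≤ r} =
      ENNReal.ofReal |ω b| * (ENNReal.ofReal r ^ 2 * ENNReal.ofReal Real.pi) := by
  have hli : LinearIndependent ℝ b := hb.linearIndependent.of_comp L
  let B := basisOfLinearIndependentOfCardEqFinrank hli
    (by rw [Fintype.card_fin, (Fact.out : Module.finrank ℝ G = 2)])
  let e : G ≃ₗ[ℝ] EuclideanSpace ℝ (Fin 2) :=
    B.equivFun ≪≫ₗ (WithLp.linearEquiv 2 ℝ (Fin 2 → ℝ)).symm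
  have hB : ⇑B = b := coe_basisOfLinearIndependentOfCardEqFinrank _ _
  have hsymm (i) : e.symm (EuclideanSpace.single i 1) = b i := by
    rw [LinearEquiv.symm_apply_eq, ← hB]
    ext j
    simp [e, Finsupp.single_apply, eq_comm]
  have hnorm (z) : ‖L z‖ = ‖e z‖ := by
    have hz : L z = ∑ i, e z i • (L ∘ b) i := by
      conv_lhs => rw [← B.sum_equivFun z]
      simp [e, hB]
    rw [← sq_eq_sq₀ (norm_nonneg _) (norm_nonneg _), EuclideanSpace.real_norm_sq_eq,
      ← real_inner_self_eq_norm_sq]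
    conv_lhs => rw [hz]
    rw [hb.inner_sum]
    simp [sq]
  have hset : {z | ‖L z‖ ≤ r} = e ⁻¹' Metric.closedBall 0 r := by
    ext z
    simp [hnorm]
  rw [hset, measure_preimage_linearEquiv, EuclideanSpace.volume_closedBall_fin_two]
  simp only [hsymm]

theorem exists_orthonormal_comp {G E : Type*} [AddCommGroup G] [Module ℝ G]
    [FiniteDimensional ℝ G] [NormedAddCommGroup E] [InnerProductSpace ℝ E] {m : ℕ}
    (hG : Module.finrank ℝ G = m) (L : G →ₗ[ℝ] E) (hL : Function.Injective L) :
    ∃ b : Fin m → G, Orthonormal ℝ (L ∘ b) := by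
  have hrank : Module.finrank ℝ L.range = m := by rw [LinearMap.finrank_range_of_inj hL, hG]
  let o := (stdOrthonormalBasis ℝ L.range).reindex (finCongr hrank)
  choose b hb using fun i => (o i).2
  refine ⟨b, ?_⟩
  have : L ∘ b = L.range.subtypeₗᵢ ∘ o := funext hb
  rw [this]
  exact o.orthonormal.comp_linearIsometry _

open scoped MatrixOrder

/-! ### Positive matrices and skew-symmetric matrices -/

section Matrix

variable {ι : Type*} [Fintype ι] [DecidableEq ι]

theorem toEuclideanLin_mul_apply (A B : Matrix ι ι ℝ) (x : EuclideanSpace ℝ ι) :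
    (A * B).toEuclideanLin x = A.toEuclideanLin (B.toEuclideanLin x) := by
  rw [Matrix.toLpLin_mul_same, LinearMap.comp_apply]

theorem inner_toEuclideanLin_left (A : Matrix ι ι ℝ) (x y : EuclideanSpace ℝ ι) :
    inner ℝ (A.toEuclideanLin x) y = inner ℝ x (A.transpose.toEuclideanLin y) := by
  rw [← Matrix.conjTranspose_eq_transpose_of_trivial,
    Matrix.toEuclideanLin_conjTranspose_eq_adjoint, LinearMap.adjoint_inner_right]

theorem inner_toEuclideanLin_self_nonneg {A : Matrix ι ι ℝ} (hA : A.PosSemidef)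
    (x : EuclideanSpace ℝ ι) : 0 ≤ inner ℝ (A.toEuclideanLin x) x := by
  have := hA.dotProduct_mulVec_nonneg x.ofLp
  simpa [EuclideanSpace.inner_eq_star_dotProduct, Matrix.toLpLin_apply] using this

/-- The spectral theorem, phrased with eigenvectors because each eigenvector of KᵀK will supply one
plane on which to test the area bound. -/
theorem posSemidef_sub_one_of_eigenvalue_ge {A : Matrix ι ι ℝ} (hA : A.IsHermitian)
    (h : ∀ (c : ℝ) (x : EuclideanSpace ℝ ι), x ≠ 0 → A.toEuclideanLin x = c • x → 1 ≤ c) :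
    (A - 1).PosSemidef := by
  have hA' : (A - 1).IsHermitian := hA.sub Matrix.isHermitian_one
  rw [hA'.posSemidef_iff_eigenvalues_nonneg]
  intro i
  have hi := hA'.mulVec_eigenvectorBasis i
  have := h (hA'.eigenvalues i + 1) (hA'.eigenvectorBasis i)
    (hA'.eigenvectorBasis.orthonormal.ne_zero i) (by
      rw [Matrix.sub_mulVec, Matrix.one_mulVec, sub_eq_iff_eq_add] at hi
      rw [Matrix.toLpLin_apply, hi, add_smul, one_smul]
      rfl)
  simpa using this

/-- A positive semidefinite matrix that dominates `1` after squaring dominates `1`. -/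
theorem posSemidef_sub_one_of_sq {P : Matrix ι ι ℝ} (hP : P.PosSemidef)
    (h : (P * P - 1).PosSemidef) : (P - 1).PosSemidef := by
  refine posSemidef_sub_one_of_eigenvalue_ge hP.1 fun c x hx hc => ?_
  have hx2 : 0 < inner ℝ x x := real_inner_self_pos.2 hx
  have h1 := inner_toEuclideanLin_self_nonneg h x
  have h2 := inner_toEuclideanLin_self_nonneg hP x
  rw [map_sub, Matrix.toLpLin_one, LinearMap.sub_apply, toEuclideanLin_mul_apply, hc, map_smul, hc,
    LinearMap.id_apply, inner_sub_left, inner_smul_left, inner_smul_left] at h1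
  rw [hc, inner_smul_left] at h2
  simp only [conj_trivial] at h1 h2
  have hc0 : 0 ≤ c := nonneg_of_mul_nonneg_left h2 hx2
  by_contra! hlt
  nlinarith [mul_nonneg hc0 hx2.le]

theorem exists_posDef_mul_self_eq {M : Matrix ι ι ℝ} (hM : M.PosDef) :
    ∃ R : Matrix ι ι ℝ, R.PosDef ∧ R * R = M :=
  ⟨CFC.sqrt M, Matrix.isStrictlyPositive_iff_posDef.1
    (IsStrictlyPositive.sqrt M (Matrix.isStrictlyPositive_iff_posDef.2 hM)),
    CFC.sqrt_mul_sqrt_self M hM.posSemidef.nonneg⟩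

theorem posDef_eq_of_mul_self_eq {A B : Matrix ι ι ℝ} (hA : A.PosDef) (hB : B.PosDef)
    (h : A * A = B * B) : A = B := by
  rw [← CFC.sqrt_mul_self A hA.posSemidef.nonneg, h, CFC.sqrt_mul_self B hB.posSemidef.nonneg]

/-- The modulus of an invertible skew-symmetric matrix. -/
theorem exists_posDef_commute_of_skew {K : Matrix ι ι ℝ} (hK : K.transpose = -K) (hu : IsUnit K) :
    ∃ P : Matrix ι ι ℝ, P.PosDef ∧ P * P = K.transpose * K ∧ Commute P K := by
  have hpos : (K.transpose * K).PosDef := by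
    have := Matrix.posSemidef_conjTranspose_mul_self K
    rw [Matrix.conjTranspose_eq_transpose_of_trivial] at this
    refine this.posDef_iff_isUnit.2 ?_
    rw [hK]
    exact hu.neg.mul hu
  refine ⟨CFC.sqrt (K.transpose * K), Matrix.isStrictlyPositive_iff_posDef.1
    (IsStrictlyPositive.sqrt _ (Matrix.isStrictlyPositive_iff_posDef.2 hpos)),
    CFC.sqrt_mul_sqrt_self _ hpos.posSemidef.nonneg, ?_⟩
  refine Commute.cfcₙ_nnreal ?_ _
  rw [hK]
  exact ((Commute.refl K).neg_left).mul_left (Commute.refl K)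

/-- If `M = R²` is dominated by `Jᵀ M⁻¹ J`, it is dominated by some `S⁻²` with `S` positive
definite and `S J S = J`. -/
theorem exists_posDef_symplectic {J R : Matrix ι ι ℝ} (hJT : J.transpose = -J) (hJ : J * J = -1)
    (hR : R.PosDef)
    (h : ((R⁻¹ * J * R⁻¹).transpose * (R⁻¹ * J * R⁻¹) - 1).PosSemidef) :
    ∃ S : Matrix ι ι ℝ, S.PosDef ∧ S * J * S = J ∧ (S⁻¹ * S⁻¹ - R * R).PosSemidef := by
  have hJu : IsUnit J := .of_mul_eq_one (-J) (by rw [mul_neg, hJ, neg_neg])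
  have hRu := hR.isUnit
  have hRd := (Matrix.isUnit_iff_isUnit_det _).1 hRu
  have hRT : R.transpose = R := hR.1
  have hRi : R⁻¹.PosDef := hR.inv
  have hRiT : R⁻¹.transpose = R⁻¹ := hRi.1
  set K := R⁻¹ * J * R⁻¹ with hKdef
  have hKT : K.transpose = -K := by
    simp [hKdef, Matrix.transpose_mul, hRiT, hJT, mul_assoc]
  have hRKR : R * K * R = J := by
    rw [hKdef, mul_assoc, mul_assoc, Matrix.nonsing_inv_mul _ hRd, mul_one,
      Matrix.mul_nonsing_inv_cancel_left _ _ hRd]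
  have hKu : IsUnit K := (hRi.isUnit.mul hJu).mul hRi.isUnit
  obtain ⟨P, hP, hPP, hPK⟩ := exists_posDef_commute_of_skew hKT hKu
  have hP1 : (P - 1).PosSemidef := posSemidef_sub_one_of_sq hP.posSemidef (by rwa [hPP])
  set N := R * P * R with hN
  have hNpos : N.PosDef := by
    have := hP.posSemidef.mul_mul_conjTranspose_same R
    rw [Matrix.conjTranspose_eq_transpose_of_trivial, hRT] at this
    exact this.posDef_iff_isUnit.2 ((hRu.mul hP.isUnit).mul hRu)
  -- As J⁻¹ = -J, this identifies RJR as -K⁻¹.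
  have hKJ : K * (R * J * R) = -1 := by
    have : R * (K * (R * J * R)) = R * -1 := by
      calc R * (K * (R * J * R)) = R * K * R * J * R := by noncomm_ring
        _ = R * -1 := by rw [hRKR, hJ]; simp
    exact hRu.mul_left_cancel this
  have hNJN : N * J * N = J := by
    -- P commutes with K and P² = KᵀK = -K², so P(RJR)P = -P²K⁻¹ = K.
    calc N * J * N = R * (P * (R * J * R) * P) * R := by rw [hN]; noncomm_ring
      _ = R * K * R := by
        congr 2
        apply hKu.mul_left_cancel
        calc K * (P * (R * J * R) * P) = P * (K * (R * J * R)) * P := by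
              rw [← mul_assoc, ← mul_assoc, ← hPK.eq]; noncomm_ring
          _ = - (P * P) := by rw [hKJ]; noncomm_ring
          _ = K * K := by rw [hPP, hKT]; noncomm_ring
      _ = J := hRKR
  obtain ⟨T, hT, hTT⟩ := exists_posDef_mul_self_eq hNpos
  have hTd := (Matrix.isUnit_iff_isUnit_det _).1 hT.isUnit
  -- N⁻¹ = JᵀNJ, and both sides here are positive definite square roots of it; uniqueness of the
  -- root passes symplecticity from N to T.
  have hTiT : T⁻¹ = J.transpose * T * J := by
    refine posDef_eq_of_mul_self_eq hT.inv ?_ ?_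
    · have := hT.posSemidef.mul_mul_conjTranspose_same J.transpose
      rw [Matrix.conjTranspose_eq_transpose_of_trivial, Matrix.transpose_transpose] at this
      refine this.posDef_iff_isUnit.2 ?_
      rw [hJT]
      exact (hJu.neg.mul hT.isUnit).mul hJu
    · rw [← Matrix.mul_inv_rev, hTT]
      refine Matrix.inv_eq_left_inv ?_
      calc J.transpose * T * J * (J.transpose * T * J) * N
          = - (J * T * (J * J) * T * -J * N) := by rw [hJT]; noncomm_ring
        _ = -(J * ((T * T) * J * N)) := by rw [hJ]; noncomm_ring
        _ = 1 := by rw [hTT, hNJN, hJ, neg_neg]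
  refine ⟨T⁻¹, hT.inv, ?_, ?_⟩
  · nth_rewrite 1 [hTiT]
    calc J.transpose * T * J * J * T⁻¹ = -J * T * (J * J) * T⁻¹ := by rw [hJT]; noncomm_ring
      _ = J * (T * T⁻¹) := by rw [hJ]; noncomm_ring
      _ = J := by rw [Matrix.mul_nonsing_inv _ hTd, mul_one]
  · rw [Matrix.nonsing_inv_nonsing_inv _ hTd, hTT]
    have := hP1.mul_mul_conjTranspose_same R
    rw [Matrix.conjTranspose_eq_transpose_of_trivial, hRT] at this
    convert this using 1
    rw [hN]
    noncomm_ring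

end Matrix

/-! ### The standard symplectic form -/

section Symplectic

variable {n : ℕ}

theorem stdJ_eq_neg_J : stdJ n = -Matrix.J (Fin n) ℝ := by
  simp [stdJ, Matrix.J, Matrix.fromBlocks_neg]

theorem stdJ_transpose : (stdJ n).transpose = -stdJ n := by
  rw [stdJ_eq_neg_J, Matrix.transpose_neg, Matrix.J_transpose]

theorem stdJ_mul_self : stdJ n * stdJ n = -1 := by
  rw [stdJ_eq_neg_J, neg_mul_neg, Matrix.J_squared]

theorem stdJ_toEuclideanLin_self (z : PhaseSpace n) :
    (stdJ n).toEuclideanLin ((stdJ n).toEuclideanLin z) = -z := by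
  rw [← toEuclideanLin_mul_apply, stdJ_mul_self, map_neg, Matrix.toLpLin_one]
  rfl

theorem norm_stdJ_toEuclideanLin (z : PhaseSpace n) : ‖(stdJ n).toEuclideanLin z‖ = ‖z‖ := by
  rw [← sq_eq_sq₀ (norm_nonneg _) (norm_nonneg _), ← real_inner_self_eq_norm_sq,
    ← real_inner_self_eq_norm_sq, inner_toEuclideanLin_left, stdJ_transpose, map_neg,
    LinearMap.neg_apply, stdJ_toEuclideanLin_self, neg_neg]

theorem mem_symplecticGroup_iff_stdJ {S : Matrix (Fin n ⊕ Fin n) (Fin n ⊕ Fin n) ℝ} :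
    S ∈ Matrix.symplecticGroup (Fin n) ℝ ↔ S * stdJ n * S.transpose = stdJ n := by
  rw [SymplecticGroup.mem_iff, stdJ_eq_neg_J, mul_neg, neg_mul, neg_inj]

theorem sigma_eq_inner (z w : PhaseSpace n) :
    sigma n z w = inner ℝ ((stdJ n).toEuclideanLin z) w := rfl

theorem sigma_swap (z w : PhaseSpace n) : sigma n z w = -sigma n w z := by
  simp only [sigma_apply, ← Finset.sum_neg_distrib]
  exact Finset.sum_congr rfl fun i _ => by ring

theorem isSymplecticPlane_span_range (b : Fin 2 → PhaseSpace n) (hb : sigma n (b 0) (b 1) ≠ 0) :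
    IsSymplecticPlane (Submodule.span ℝ (Set.range b)) := by
  have hspan (c d : ℝ) (h0 : sigma n (c • b 0 + d • b 1) (b 0) = 0)
      (h1 : sigma n (c • b 0 + d • b 1) (b 1) = 0) : c = 0 ∧ d = 0 := by
    simp only [map_add, map_smul, LinearMap.add_apply, LinearMap.smul_apply, sigma_self,
      sigma_swap (b 1) (b 0), smul_eq_mul, mul_zero, add_zero, zero_add, mul_neg,
      neg_eq_zero] at h0 h1
    exact ⟨(mul_eq_zero.1 h1).resolve_right hb, (mul_eq_zero.1 h0).resolve_right hb⟩
  have hmem (i) : b i ∈ Submodule.span ℝ (Set.range b) := Submodule.subset_span ⟨i, rfl⟩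
  have hleft : ((sigma n).restrict (Submodule.span ℝ (Set.range b))).SeparatingLeft := by
    rintro ⟨z, hz⟩ h
    obtain ⟨c, rfl⟩ := (Submodule.mem_span_range_iff_exists_fun ℝ).1 hz
    have h0 := h ⟨b 0, hmem 0⟩
    have h1 := h ⟨b 1, hmem 1⟩
    rw [LinearMap.BilinForm.restrict_apply] at h0 h1
    simp only [LinearMap.domRestrict_apply, Fin.sum_univ_two] at h0 h1
    obtain ⟨hc, hd⟩ := hspan _ _ h0 h1
    ext1
    simp [Fin.sum_univ_two, hc, hd]
  refine ⟨?_, hleft, fun w hw => hleft w fun z => ?_⟩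
  · refine finrank_span_eq_card (b := b) ?_ |>.trans (Fintype.card_fin 2)
    have : b = ![b 0, b 1] := by ext i; fin_cases i <;> rfl
    rw [this, LinearIndependent.pair_iff]
    intro c d h
    exact hspan c d (by rw [h]; simp) (by rw [h]; simp)
  · have := hw z
    rw [LinearMap.BilinForm.restrict_apply, LinearMap.domRestrict_apply] at this ⊢
    rw [sigma_swap, this, neg_zero]

/-! ### Ellipsoids and their polar duals -/

/-- Since σ(z, w) = -⟨Rz, QJw⟩, this is duality of Euclidean balls. Keeping Q separate from R serves
both ellipsoids (Q = R⁻¹) and blobs (S⁻¹ with Q = Sᵀ). -/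
theorem symplecticPolar_norm_le {hbar : ℝ} (hhbar : 0 < hbar)
    {R Q : Matrix (Fin n ⊕ Fin n) (Fin n ⊕ Fin n) ℝ} (hRQ : R * Q.transpose = 1) :
    symplecticPolar hbar {z : PhaseSpace n | ‖R.toEuclideanLin z‖ ≤ √hbar} =
      {w | ‖Q.toEuclideanLin ((stdJ n).toEuclideanLin w)‖ ≤ √hbar} := by
  have hQR : R.transpose * Q = 1 := by
    rw [← Matrix.transpose_transpose Q, ← Matrix.transpose_mul, mul_eq_one_comm.1 hRQ,
      Matrix.transpose_one]
  have hsq : √hbar * √hbar = hbar := Real.mul_self_sqrt hhbar.le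
  have hσ (z w : PhaseSpace n) : sigma n z w =
      -inner ℝ (R.toEuclideanLin z) (Q.toEuclideanLin ((stdJ n).toEuclideanLin w)) := by
    rw [inner_toEuclideanLin_left, ← toEuclideanLin_mul_apply, hQR, sigma_eq_inner,
      inner_toEuclideanLin_left, stdJ_transpose, Matrix.toLpLin_one, map_neg]
    simp
  ext w
  simp only [symplecticPolar, Set.mem_ofPred_eq]
  set q := Q.toEuclideanLin ((stdJ n).toEuclideanLin w) with hq
  constructor
  · intro h
    rcases eq_or_ne q 0 with h0 | h0
    · simp [h0]
    have hpos : 0 < ‖q‖ := norm_pos_iff.2 h0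
    -- The test point z has Rz antiparallel to q with norm √ħ, the equality case of Cauchy–Schwarz.
    have hz : R.toEuclideanLin (Q.transpose.toEuclideanLin (-(√hbar / ‖q‖) • q)) =
        -(√hbar / ‖q‖) • q := by
      rw [← toEuclideanLin_mul_apply, hRQ, Matrix.toLpLin_one]; rfl
    have := h (Q.transpose.toEuclideanLin (-(√hbar / ‖q‖) • q)) (by
      rw [hz, norm_smul, norm_neg, Real.norm_of_nonneg (by positivity),
        div_mul_cancel₀ _ hpos.ne'])
    rw [hσ, hz, ← hq, inner_smul_left, real_inner_self_eq_norm_sq] at this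
    simp only [conj_trivial] at this
    have h2 : √hbar * ‖q‖ ≤ √hbar * √hbar := by
      rw [hsq]
      refine le_of_eq_of_le ?_ this
      field_simp
    exact le_of_mul_le_mul_left h2 (Real.sqrt_pos.2 hhbar)
  · intro h z hz
    rw [hσ, ← hq]
    calc _ ≤ ‖R.toEuclideanLin z‖ * ‖q‖ := by
          rw [← inner_neg_right, ← norm_neg q]; exact real_inner_le_norm _ _
      _ ≤ √hbar * √hbar := by gcongr
      _ = hbar := hsq

theorem ellipsoid_mul_self {hbar : ℝ} (hhbar : 0 ≤ hbar)
    {R : Matrix (Fin n ⊕ Fin n) (Fin n ⊕ Fin n) ℝ}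
    (hR : R.IsHermitian) :
    ellipsoid hbar (R * R) = {z : PhaseSpace n | ‖R.toEuclideanLin z‖ ≤ √hbar} := by
  have hRT : R.transpose = R := hR
  ext z
  rw [ellipsoid, Set.mem_ofPred_eq, Set.mem_ofPred_eq, toEuclideanLin_mul_apply,
    inner_toEuclideanLin_left, hRT, real_inner_self_eq_norm_sq]
  exact (Real.le_sqrt (norm_nonneg _) hhbar).symm

theorem quantumBlob_eq_norm_le (hbar : ℝ) {S : Matrix (Fin n ⊕ Fin n) (Fin n ⊕ Fin n) ℝ}
    (hS : IsUnit S) : quantumBlob hbar S = {z | ‖S⁻¹.toEuclideanLin z‖ ≤ √hbar} := by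
  have hd := (Matrix.isUnit_iff_isUnit_det _).1 hS
  ext z
  simp only [quantumBlob, Set.mem_image, mem_closedBall_zero_iff, Set.mem_ofPred_eq]
  constructor
  · rintro ⟨b, hb, rfl⟩
    rw [← toEuclideanLin_mul_apply, Matrix.nonsing_inv_mul _ hd, Matrix.toLpLin_one]
    exact hb
  · intro h
    refine ⟨_, h, ?_⟩
    rw [← toEuclideanLin_mul_apply, Matrix.mul_nonsing_inv _ hd, Matrix.toLpLin_one]
    rfl

/-- Quantum blobs are fixed by symplectic polar duality. -/
theorem symplecticPolar_quantumBlob {hbar : ℝ} (hhbar : 0 < hbar)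
    {S : Matrix (Fin n ⊕ Fin n) (Fin n ⊕ Fin n) ℝ} (hS : S ∈ Matrix.symplecticGroup (Fin n) ℝ) :
    symplecticPolar hbar (quantumBlob hbar S) = quantumBlob hbar S := by
  have hd := SymplecticGroup.symplectic_det hS
  have hST := mem_symplecticGroup_iff_stdJ.1 (SymplecticGroup.transpose_mem hS)
  rw [Matrix.transpose_transpose] at hST
  -- Hence ‖SᵀJw‖ = ‖JS⁻¹w‖ = ‖S⁻¹w‖, because J is an isometry.
  have hSJ : S.transpose * stdJ n = stdJ n * S⁻¹ := by
    conv_rhs => rw [← hST, Matrix.mul_nonsing_inv_cancel_right _ _ hd]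
  rw [quantumBlob_eq_norm_le hbar ((Matrix.isUnit_iff_isUnit_det _).2 hd),
    symplecticPolar_norm_le hhbar (Q := S.transpose)
      (by rw [Matrix.transpose_transpose, Matrix.nonsing_inv_mul _ hd])]
  ext w
  rw [Set.mem_ofPred_eq, Set.mem_ofPred_eq, ← toEuclideanLin_mul_apply, hSJ,
    toEuclideanLin_mul_apply, norm_stdJ_toEuclideanLin]

theorem symplecticPolar_anti (hbar : ℝ) {A B : Set (PhaseSpace n)} (h : A ⊆ B) :
    symplecticPolar hbar B ⊆ symplecticPolar hbar A :=
  fun _ hw z hz => hw z (h hz)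

theorem symplecticPolar_subset_of_quantumAdmissible {hbar : ℝ} (hhbar : 0 < hbar)
    {A : Set (PhaseSpace n)} (hA : QuantumAdmissible hbar A) : symplecticPolar hbar A ⊆ A := by
  obtain ⟨S, hS, hSA⟩ := hA
  exact (symplecticPolar_anti hbar hSA).trans
    ((symplecticPolar_quantumBlob hhbar hS).subset.trans hSA)

variable {R : Matrix (Fin n ⊕ Fin n) (Fin n ⊕ Fin n) ℝ}

theorem symplecticPolar_ellipsoid_mul_self {hbar : ℝ} (hhbar : 0 < hbar) (hR : R.PosDef) :
    symplecticPolar hbar (ellipsoid hbar (R * R)) =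
      {w | ‖(R⁻¹ * stdJ n).toEuclideanLin w‖ ≤ √hbar} := by
  have hRi : R⁻¹.transpose = R⁻¹ := hR.inv.1
  rw [ellipsoid_mul_self hhbar.le hR.1, symplecticPolar_norm_le hhbar (Q := R⁻¹)
    (by rw [hRi, Matrix.mul_nonsing_inv _ ((Matrix.isUnit_iff_isUnit_det _).1 hR.isUnit)])]
  simp only [toEuclideanLin_mul_apply]

theorem toEuclideanLin_injective_of_isUnit {ι : Type*} [Fintype ι] [DecidableEq ι]
    {A : Matrix ι ι ℝ} (hA : IsUnit A) : Function.Injective A.toEuclideanLin := by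
  intro x y h
  have := congrArg A⁻¹.toEuclideanLin h
  rwa [← toEuclideanLin_mul_apply, ← toEuclideanLin_mul_apply,
    Matrix.nonsing_inv_mul _ ((Matrix.isUnit_iff_isUnit_det _).1 hA), Matrix.toLpLin_one] at this

theorem isUnit_stdJ : IsUnit (stdJ n) :=
  .of_mul_eq_one (-stdJ n) (by rw [mul_neg, stdJ_mul_self, neg_neg])

/-- An inclusion of two ellipsoids is an inequality of norms. -/
theorem norm_le_norm_of_setOf_subset {V E E' : Type*} [AddCommGroup V] [Module ℝ V]
    [NormedAddCommGroup E] [NormedSpace ℝ E] [NormedAddCommGroup E'] [NormedSpace ℝ E']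
    (f : V →ₗ[ℝ] E) (g : V →ₗ[ℝ] E') (hf : Function.Injective f) {r : ℝ} (hr : 0 < r)
    (h : {w | ‖f w‖ ≤ r} ⊆ {w | ‖g w‖ ≤ r}) (w : V) : ‖g w‖ ≤ ‖f w‖ := by
  rcases eq_or_ne w 0 with rfl | hw
  · simp
  have hpos : 0 < ‖f w‖ := norm_pos_iff.2 fun h0 => hw (hf (h0.trans (map_zero f).symm))
  have hmem : (r / ‖f w‖) • w ∈ {w | ‖f w‖ ≤ r} := by
    rw [Set.mem_ofPred_eq, map_smul, norm_smul, Real.norm_of_nonneg (by positivity),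
      div_mul_cancel₀ _ hpos.ne']
  have h2 := h hmem
  rw [Set.mem_ofPred_eq, map_smul, norm_smul, Real.norm_of_nonneg (by positivity),
    div_mul_eq_mul_div, div_le_iff₀ hpos] at h2
  exact le_of_mul_le_mul_left h2 hr

/-! ### Plane sections of the polar dual and the remaining implications -/

theorem areaInter_norm_le (F : Submodule ℝ (PhaseSpace n)) (hF : Module.finrank ℝ F = 2)
    (L : PhaseSpace n →ₗ[ℝ] PhaseSpace n) (b : Fin 2 → F)
    (hb : Orthonormal ℝ fun i => L (b i)) {hbar : ℝ} (hhbar : 0 < hbar) :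
    areaInter {w | ‖L w‖ ≤ √hbar} F hF =
      ENNReal.ofReal (|sigma n (b 0) (b 1)| * (Real.pi * hbar)) := by
  have : Fact (Module.finrank ℝ F = 2) := ⟨hF⟩
  refine (measure_norm_apply_le (sigmaForm F) (L ∘ₗ F.subtype) b hb (√hbar)).trans ?_
  rw [← ENNReal.ofReal_pow (Real.sqrt_nonneg _), Real.sq_sqrt hhbar.le,
    ← ENNReal.ofReal_mul hhbar.le, mul_comm hbar, ← ENNReal.ofReal_mul (abs_nonneg _)]
  rfl

theorem areaInter_symplecticPolar_le {hbar : ℝ} (hhbar : 0 < hbar) (hR : R.PosDef)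
    (h : symplecticPolar hbar (ellipsoid hbar (R * R)) ⊆ ellipsoid hbar (R * R))
    (F : Submodule ℝ (PhaseSpace n)) (hF : Module.finrank ℝ F = 2) :
    areaInter (symplecticPolar hbar (ellipsoid hbar (R * R))) F hF ≤
      ENNReal.ofReal (Real.pi * hbar) := by
  have hRi : R⁻¹.transpose = R⁻¹ := hR.inv.1
  have hRd := (Matrix.isUnit_iff_isUnit_det _).1 hR.isUnit
  have hinj := toEuclideanLin_injective_of_isUnit (hR.inv.isUnit.mul (isUnit_stdJ (n := n)))
  rw [symplecticPolar_ellipsoid_mul_self hhbar hR] at h ⊢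
  rw [ellipsoid_mul_self hhbar.le hR.1] at h
  have hle := norm_le_norm_of_setOf_subset _ _ hinj (Real.sqrt_pos.2 hhbar) h
  obtain ⟨b, hb⟩ := exists_orthonormal_comp hF
    ((R⁻¹ * stdJ n).toEuclideanLin ∘ₗ F.subtype) (hinj.comp F.subtype_injective)
  have hb' : Orthonormal ℝ fun i => (R⁻¹ * stdJ n).toEuclideanLin (b i) := hb
  rw [areaInter_norm_le F hF _ b hb' hhbar]
  refine ENNReal.ofReal_le_ofReal (mul_le_of_le_one_left (by positivity) ?_)
  -- The first factor is a unit vector; the second has norm at most 1 because the inclusion gives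
  -- ‖Rw‖ ≤ ‖R⁻¹Jw‖.
  have hσ : sigma n (b 0) (b 1) =
      inner ℝ ((R⁻¹ * stdJ n).toEuclideanLin (b 0)) (R.toEuclideanLin (b 1)) := by
    rw [toEuclideanLin_mul_apply, inner_toEuclideanLin_left, hRi, ← toEuclideanLin_mul_apply,
      Matrix.nonsing_inv_mul _ hRd, Matrix.toLpLin_one]
    rfl
  rw [hσ]
  calc _ ≤ _ := abs_real_inner_le_norm _ _
    _ ≤ 1 * 1 := by
      gcongr
      · exact (hb'.1 0).le
      · exact (hle _).trans (hb'.1 1).le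
    _ = 1 := one_mul 1

/-- A bound on the areas of all symplectic sections of the polar dual bounds `M = R²` by
`Jᵀ M⁻¹ J`. -/
theorem posSemidef_sub_one_of_areaInter_le {hbar : ℝ} (hhbar : 0 < hbar) (hR : R.PosDef)
    (h : ∀ (F : Submodule ℝ (PhaseSpace n)) (hF : IsSymplecticPlane F),
      areaInter (symplecticPolar hbar (ellipsoid hbar (R * R))) F hF.finrank_eq ≤
        ENNReal.ofReal (Real.pi * hbar)) :
    ((R⁻¹ * stdJ n * R⁻¹).transpose * (R⁻¹ * stdJ n * R⁻¹) - 1).PosSemidef := by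
  have hRi : R⁻¹.transpose = R⁻¹ := hR.inv.1
  set K := R⁻¹ * stdJ n * R⁻¹ with hK
  have hKT : K.transpose = -K := by
    simp [hK, Matrix.transpose_mul, hRi, stdJ_transpose, mul_assoc]
  have hKu : IsUnit K := (hR.inv.isUnit.mul isUnit_stdJ).mul hR.inv.isUnit
  have hherm : (K.transpose * K).IsHermitian := Matrix.isHermitian_conjTranspose_mul_self K
  refine posSemidef_sub_one_of_eigenvalue_ge hherm fun c x hx hc => ?_
  rw [toEuclideanLin_mul_apply] at hc
  set y := K.toEuclideanLin x with hy
  have hy0 : y ≠ 0 := fun h0 =>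
    hx (toEuclideanLin_injective_of_isUnit hKu (h0.trans (map_zero _).symm))
  have hxpos : 0 < ‖x‖ := norm_pos_iff.2 hx
  have hypos : 0 < ‖y‖ := norm_pos_iff.2 hy0
  have hKy : K.toEuclideanLin y = -(c • x) := by
    rw [← hc, hKT, map_neg, LinearMap.neg_apply, neg_neg]
  have hnorm : ‖y‖ ^ 2 = c * ‖x‖ ^ 2 := by
    rw [← real_inner_self_eq_norm_sq, ← real_inner_self_eq_norm_sq]
    nth_rewrite 1 [hy]
    rw [inner_toEuclideanLin_left, hc, inner_smul_right]
  have hcpos : 0 < c := by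
    by_contra! hneg
    nlinarith [pow_pos hypos 2, pow_pos hxpos 2]
  have hxy : inner ℝ y x = 0 := by
    have hskew := inner_toEuclideanLin_left K x x
    rw [hKT, map_neg, LinearMap.neg_apply, ← hy, inner_neg_right] at hskew
    linarith [real_inner_comm x y]
  -- R⁻¹J sends R⁻¹x to y and R⁻¹y to Ky = -cx. These images are orthogonal, and the scalars
  -- normalize them.
  let b : Fin 2 → PhaseSpace n :=
    ![‖y‖⁻¹ • R⁻¹.toEuclideanLin x, (c * ‖x‖)⁻¹ • R⁻¹.toEuclideanLin y]
  have hb0 : (R⁻¹ * stdJ n).toEuclideanLin (b 0) = ‖y‖⁻¹ • y := by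
    simp only [b, Matrix.cons_val_zero, map_smul]
    rw [← toEuclideanLin_mul_apply]
  have hb1 : (R⁻¹ * stdJ n).toEuclideanLin (b 1) = (c * ‖x‖)⁻¹ • -(c • x) := by
    have : b 1 = (c * ‖x‖)⁻¹ • R⁻¹.toEuclideanLin y := rfl
    rw [this, map_smul, ← toEuclideanLin_mul_apply, ← hK, hKy]
  have hσ : sigma n (b 0) (b 1) = ‖y‖ / (c * ‖x‖) := by
    have : sigma n (R⁻¹.toEuclideanLin x) (R⁻¹.toEuclideanLin y) = ‖y‖ ^ 2 := by
      rw [sigma_eq_inner, ← real_inner_self_eq_norm_sq]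
      nth_rewrite 2 [hy]
      rw [hK, mul_assoc, toEuclideanLin_mul_apply, toEuclideanLin_mul_apply,
        inner_toEuclideanLin_left R⁻¹, hRi]
    simp only [b, Matrix.cons_val_zero, Matrix.cons_val_one, map_smul, LinearMap.smul_apply, this,
      smul_eq_mul]
    field_simp
  have hF := isSymplecticPlane_span_range b (by rw [hσ]; positivity)
  have hortho : Orthonormal ℝ fun i => (R⁻¹ * stdJ n).toEuclideanLin (b i) := by
    have hn0 : ‖‖y‖⁻¹ • y‖ = 1 := by
      rw [norm_smul, norm_inv, norm_norm, inv_mul_cancel₀ hypos.ne']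
    have hn1 : ‖(c * ‖x‖)⁻¹ • -(c • x)‖ = 1 := by
      rw [norm_smul, norm_neg, norm_smul, Real.norm_of_nonneg (by positivity),
        Real.norm_of_nonneg hcpos.le, inv_mul_cancel₀ (by positivity)]
    have hin : inner ℝ (‖y‖⁻¹ • y) ((c * ‖x‖)⁻¹ • -(c • x)) = 0 := by
      rw [inner_smul_left, inner_smul_right, inner_neg_right, inner_smul_right, hxy]
      simp
    constructor
    · intro i
      fin_cases i
      · exact (congrArg norm hb0).trans hn0
      · exact (congrArg norm hb1).trans hn1
    · intro i j hij
      fin_cases i <;> fin_cases j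
      · exact absurd rfl hij
      · exact (congrArg₂ (inner ℝ) hb0 hb1).trans hin
      · exact (congrArg₂ (inner ℝ) hb1 hb0).trans ((real_inner_comm _ _).trans hin)
      · exact absurd rfl hij
  have harea := h _ hF
  rw [symplecticPolar_ellipsoid_mul_self hhbar hR,
    areaInter_norm_le _ hF.finrank_eq _ (fun i => ⟨b i, Submodule.subset_span ⟨i, rfl⟩⟩) hortho
      hhbar,
    ENNReal.ofReal_le_ofReal_iff (by positivity), hσ, abs_of_pos (by positivity)] at harea
  have hle : ‖y‖ / (c * ‖x‖) ≤ 1 :=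
    le_of_mul_le_mul_right (harea.trans_eq (one_mul _).symm) (by positivity)
  rw [div_le_one (by positivity)] at hle
  -- Squaring ‖y‖ ≤ c‖x‖ and using ‖y‖² = c‖x‖² gives c ≤ c².
  have hsq : c * ‖x‖ ^ 2 ≤ (c * ‖x‖) ^ 2 := by
    rw [← hnorm]; gcongr
  by_contra! hlt
  nlinarith [mul_pos hcpos (pow_pos hxpos 2)]

theorem quantumAdmissible_ellipsoid_of_posSemidef {hbar : ℝ} (hhbar : 0 < hbar) (hR : R.PosDef)
    (h : ((R⁻¹ * stdJ n * R⁻¹).transpose * (R⁻¹ * stdJ n * R⁻¹) - 1).PosSemidef) :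
    QuantumAdmissible hbar (ellipsoid hbar (R * R)) := by
  obtain ⟨S, hS, hSJ, hle⟩ := exists_posDef_symplectic stdJ_transpose stdJ_mul_self hR h
  have hST : S.transpose = S := hS.1
  refine ⟨S, mem_symplecticGroup_iff_stdJ.2 (by rw [hST, hSJ]), fun z hz => ?_⟩
  rw [quantumBlob_eq_norm_le hbar hS.isUnit,
    ← ellipsoid_mul_self hhbar.le hS.inv.1, ellipsoid, Set.mem_ofPred_eq] at hz
  rw [ellipsoid, Set.mem_ofPred_eq]
  have := inner_toEuclideanLin_self_nonneg hle z
  rw [map_sub, LinearMap.sub_apply, inner_sub_left] at this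
  linarith

end Symplectic

end SymplecticPolarity

theorem theorem2 (n : ℕ) (hbar : ℝ) (hhbar : 0 < hbar)
    (M : Matrix (Fin n ⊕ Fin n) (Fin n ⊕ Fin n) ℝ) (hM : M.PosDef) :
    List.TFAE
      [SymplecticPolarity.QuantumAdmissible hbar (SymplecticPolarity.ellipsoid hbar M),
       SymplecticPolarity.symplecticPolar hbar (SymplecticPolarity.ellipsoid hbar M) ⊆
         SymplecticPolarity.ellipsoid hbar M,
       ∀ (F : Submodule ℝ (SymplecticPolarity.PhaseSpace n))
         (hF : SymplecticPolarity.IsSymplecticPlane F),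
         SymplecticPolarity.areaInter
           (SymplecticPolarity.symplecticPolar hbar (SymplecticPolarity.ellipsoid hbar M)) F
           hF.finrank_eq ≤ ENNReal.ofReal (Real.pi * hbar)] := by
  obtain ⟨R, hR, rfl⟩ := SymplecticPolarity.exists_posDef_mul_self_eq hM
  tfae_have 1 → 2 := SymplecticPolarity.symplecticPolar_subset_of_quantumAdmissible hhbar
  tfae_have 2 → 3 := fun h F hF =>
    SymplecticPolarity.areaInter_symplecticPolar_le hhbar hR h F hF.finrank_eq
  tfae_have 3 → 1 := fun h => SymplecticPolarity.quantumAdmissible_ellipsoid_of_posSemidef hhbar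
    hR (SymplecticPolarity.posSemidef_sub_one_of_areaInter_le hhbar hR h)
  tfae_finish
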